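/- Consider the tense language with countably many propositional variables, connectives $\bot,\to$, and operators $\Box$ (future necessity) and $\blacklozenge$ (past possibility). A \emph{tense logic} is a set of formulas that contains all classical tautologies, is closed under modus ponens and uniform substitution, and contains $\blacklozenge\varphi\to\psi$ if and only if it contains $\varphi\to\Box\psi$, for all formulas $\varphi,\psi$. Let $\mathsf{K4}_t$ be the least tense logic containing $\Box p\to\Box\Box p$, and let $\mathsf{NExt}(\mathsf{K4}_t)$ be the set of all tense logics that contain $\mathsf{K4}_t$, ordered by inclusion. For a tense logic $L$, let $\mathsf{Fr}(L)$ be the class of all Kripke frames $(X,R)$ with $X\neq\varnothing$ that validate every formula of $L$, where $\Box$ is interpreted by $R$ and $\blacklozenge$ by the inverse of $R$. The degree of Kripke-incompleteness of $L\in\mathsf{NExt}(\mathsf{K4}_t)$ is the cardinal $$\mathsf{deg}_{\mathsf{K4}_t}(L)=\bigl|\{L'\in\mathsf{NExt}(\mathsf{K4}_t):\mathsf{Fr}(L')=\mathsf{Fr}(L)\}\bigr|.$$ Let $\bullet$ be the frame with exactly one point and empty relation, and let $\mathsf{Log}(\bullet)$ be the set of formulas valid in it. \textbf{Theorem.} There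 is a unique logic $\mathsf{K4}_t/\bullet\in\mathsf{NExt}(\mathsf{K4}_t)$ such that every $L\in\mathsf{NExt}(\mathsf{K4}_t)$ satisfies exactly one of $L\subseteq\mathsf{Log}(\bullet)$ and $L\supseteq\mathsf{K4}_t/\bullet$ (that is, $\langle\mathsf{Log}(\bullet),\mathsf{K4}_t/\bullet\rangle$ is a splitting pair in $\mathsf{NExt}(\mathsf{K4}_t)$). For every $L\in\mathsf{NExt}(\mathsf{K4}_t)$ with $L\neq\mathsf{K4}_t$ and $L\neq\mathsf{K4}_t/\bullet$, $$\mathsf{deg}_{\mathsf{K4}_t}(L)=2^{\aleph_0}.$$ -/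

import Mathlib

universe u

namespace TenseLogic

/-- Formulas of the tense language: variables `p i`, falsum, implication, the future necessity
`□` and the past possibility `⧫`. -/
inductive Formula : Type
  | var : ℕ → Formula
  | bot : Formula
  | imp : Formula → Formula → Formula
  | box : Formula → Formula
  | pdia : Formula → Formula

/-- The substitution (endomorphism of the formula algebra) determined by `s` on variables. -/
def Formula.subst (s : ℕ → Formula) : Formula → Formula
  | .var i => s i
  | .bot => .bot
  | .imp φ ψ => .imp (φ.subst s) (ψ.subst s)
  | .box φ => .box (φ.subst s)
  | .pdia φ => .pdia (φ.subst s)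

/-- Classical tautologies in the tense language: true under every two-valued assignment that
respects falsum and implication (variables and formulas `□φ`, `⧫φ` count as atoms). -/
def IsTautology (φ : Formula) : Prop :=
  ∀ e : Formula → Prop, ¬ e .bot → (∀ α β, e (.imp α β) ↔ (e α → e β)) → e φ

/-- Tense logics, as sets of formulas. -/
structure IsTenseLogic (L : Set Formula) : Prop where
  taut : ∀ φ, IsTautology φ → φ ∈ L
  adj : ∀ φ ψ, Formula.imp (.pdia φ) ψ ∈ L ↔ Formula.imp φ (.box ψ) ∈ L
  mp : ∀ φ ψ, φ ∈ L → Formula.imp φ ψ ∈ L → ψ ∈ L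
  subst : ∀ φ (s : ℕ → Formula), φ ∈ L → φ.subst s ∈ L

/-- `L ⊕ Σ`, the smallest tense logic containing `L ∪ Σ`. -/
def oplus (L S : Set Formula) : Set Formula :=
  ⋂₀ {L' | IsTenseLogic L' ∧ L ∪ S ⊆ L'}

/-- The least tense logic `K_t`. -/
def Kt : Set Formula := ⋂₀ {L | IsTenseLogic L}

/-- The axiom `□p → □□p`. -/
def axiom4 : Formula := .imp (.box (.var 0)) (.box (.box (.var 0)))

/-- The transitive tense logic `K4_t = K_t ⊕ (□p → □□p)`. -/
def K4t : Set Formula := oplus Kt {axiom4}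

/-- `NExt(L)`, the set of all tense logics extending `L`. -/
def NExt (L : Set Formula) : Set (Set Formula) := {L' | IsTenseLogic L' ∧ L ⊆ L'}

/-- (Kripke) frames: a nonempty set with a binary relation. -/
structure Frame : Type (u + 1) where
  carrier : Type u
  nonempty : Nonempty carrier
  rel : carrier → carrier → Prop

/-- The extension of a valuation in a frame to all formulas. -/
def Frame.val (F : Frame.{u}) (V : ℕ → Set F.carrier) : Formula → Set F.carrier
  | .var i => V i
  | .bot => ∅
  | .imp φ ψ => (F.val V φ)ᶜ ∪ F.val V ψ
  | .box φ => {x | ∀ y, F.rel x y → y ∈ F.val V φ}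
  | .pdia φ => {y | ∃ x ∈ F.val V φ, F.rel x y}

/-- `φ` is valid in `F`: it is true at every point under every valuation. -/
def Frame.Valid (F : Frame.{u}) (φ : Formula) : Prop :=
  ∀ (V : ℕ → Set F.carrier) (x : F.carrier), x ∈ F.val V φ

/-- `Fr(L)`, the class of frames validating every formula of `L`. -/
def Fr (L : Set Formula) : Set Frame.{u} := {F | ∀ φ ∈ L, F.Valid φ}

/-- `Log(𝒦)`, the set of formulas valid in every frame of the class `𝒦`. -/
def Log (K : Set Frame.{u}) : Set Formula := {φ | ∀ F ∈ K, F.Valid φ}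

/-- The frame `•`: one point, empty relation. -/
def bullet : Frame.{0} where
  carrier := Unit
  nonempty := ⟨()⟩
  rel := fun _ _ => False

/-- `⟨L₁, L₂⟩` is a splitting pair in `NExt(L₀)`; then `L₂` is denoted `L₀/L₁`. -/
def IsSplittingPair (L₀ L₁ L₂ : Set Formula) : Prop :=
  L₁ ∈ NExt L₀ ∧ L₂ ∈ NExt L₀ ∧ ∀ L ∈ NExt L₀, Xor (L ⊆ L₁) (L₂ ⊆ L)

/-- The degree of Kripke-incompleteness of `L` in `NExt(L₀)`: the number of logics in `NExt(L₀)`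
with exactly the same frames as `L`. -/
noncomputable def deg (L₀ L : Set Formula) : Cardinal.{0} :=
  Cardinal.mk {L' : Set Formula // L' ∈ NExt L₀ ∧ Fr.{u} L' = Fr.{u} L}

end TenseLogic

namespace TenseLogic

/-! ### Derived connectives -/

/-- Negation. -/
def neg (φ : Formula) : Formula := .imp φ .bot

/-- Conjunction. -/
def conj (φ ψ : Formula) : Formula := neg (.imp φ (neg ψ))

/-- Future possibility. -/
def dia (φ : Formula) : Formula := neg (.box (neg φ))

/-- Past necessity. -/
def hist (φ : Formula) : Formula := neg (.pdia (neg φ))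

/-- The formula `□⊥ ∧ ¬⧫⊤`, true exactly at isolated points. -/
def isolated : Formula := conj (.box .bot) (neg (.pdia (neg .bot)))

/-! ### Tense logics -/

namespace IsTenseLogic

variable {L : Set Formula} (h : IsTenseLogic L)
include h

theorem imp_trans {a b c : Formula} (h₁ : .imp a b ∈ L) (h₂ : .imp b c ∈ L) : .imp a c ∈ L :=
  h.mp _ _ h₂ (h.mp _ _ h₁ (h.taut _ (by intro e hb hi; simp only [hi]; tauto)))

theorem pdia_mono {a b : Formula} (hab : .imp a b ∈ L) : .imp (.pdia a) (.pdia b) ∈ L :=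
  (h.adj _ _).2 (h.imp_trans hab ((h.adj _ _).1 (h.taut _ (by
    intro e hb hi; simp only [hi]; tauto))))

theorem pdia_box (a : Formula) : .imp (.pdia (.box a)) a ∈ L :=
  (h.adj _ _).2 (h.taut _ (by intro e hb hi; simp only [hi]; tauto))

theorem box_pdia (a : Formula) : .imp a (.box (.pdia a)) ∈ L :=
  (h.adj _ _).1 (h.taut _ (by intro e hb hi; simp only [hi]; tauto))

theorem box_mono {a b : Formula} (hab : .imp a b ∈ L) : .imp (.box a) (.box b) ∈ L :=
  (h.adj _ _).1 (h.imp_trans (h.pdia_box a) hab)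

theorem box_mem {a : Formula} (ha : a ∈ L) : .box a ∈ L := by
  have h1 : .imp (neg .bot) (.box a) ∈ L := (h.adj _ _).1
    (h.mp _ _ ha (h.taut _ (by intro e hb hi; simp only [hi]; tauto)))
  exact h.mp _ _ (h.taut _ (by intro e hb hi; simp only [neg, hi]; tauto)) h1

theorem hist_mem {a : Formula} (ha : a ∈ L) : hist a ∈ L :=
  (h.adj _ _).2 (h.mp _ _ ha (h.taut _ (by intro e hb hi; simp only [neg, hi]; tauto)))

theorem box_imp (a b : Formula) :
    .imp (.box (.imp a b)) (.imp (.box a) (.box b)) ∈ L := by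
  have h1 : .imp (.pdia (conj (.box (.imp a b)) (.box a))) (.imp a b) ∈ L :=
    h.imp_trans (h.pdia_mono (h.taut _ (by intro e hb hi; simp only [conj, neg, hi]; tauto)))
      (h.pdia_box _)
  have h2 : .imp (.pdia (conj (.box (.imp a b)) (.box a))) a ∈ L :=
    h.imp_trans (h.pdia_mono (h.taut _ (by intro e hb hi; simp only [conj, neg, hi]; tauto)))
      (h.pdia_box _)
  have h3 := (h.adj _ _).1 (h.mp _ _ h2 (h.mp _ _ h1 (h.taut (.imp
    (.imp (.pdia (conj (.box (.imp a b)) (.box a))) (.imp a b))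
    (.imp (.imp (.pdia (conj (.box (.imp a b)) (.box a))) a)
      (.imp (.pdia (conj (.box (.imp a b)) (.box a))) b)))
    (by intro e hb hi; simp only [hi]; tauto))))
  exact h.mp _ _ h3 (h.taut _ (by intro e hb hi; simp only [conj, neg, hi]; tauto))

theorem pdia_or (a b : Formula) :
    .imp (.pdia (.imp (neg a) b)) (.imp (neg (.pdia a)) (.pdia b)) ∈ L := by
  refine (h.adj _ _).2 ?_
  have h1 := h.imp_trans (h.box_pdia a) (h.box_mono (b := .imp (neg (.pdia a)) (.pdia b))
    (h.taut _ (by intro e hb hi; simp only [neg, hi]; tauto)))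
  have h2 := h.imp_trans (h.box_pdia b) (h.box_mono (b := .imp (neg (.pdia a)) (.pdia b))
    (h.taut _ (by intro e hb hi; simp only [neg, hi]; tauto)))
  exact h.mp _ _ h2 (h.mp _ _ h1 (h.taut _ (by intro e hb hi; simp only [neg, hi]; tauto)))

theorem inter {L' : Set Formula} (h' : IsTenseLogic L') : IsTenseLogic (L ∩ L') where
  taut φ hφ := ⟨h.taut φ hφ, h'.taut φ hφ⟩
  adj φ ψ := and_congr (h.adj φ ψ) (h'.adj φ ψ)
  mp φ ψ h₁ h₂ := ⟨h.mp φ ψ h₁.1 h₂.1, h'.mp φ ψ h₁.2 h₂.2⟩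
  subst φ s hφ := ⟨h.subst φ s hφ.1, h'.subst φ s hφ.2⟩

end IsTenseLogic

theorem isTenseLogic_sInter {S : Set (Set Formula)} (hS : ∀ L ∈ S, IsTenseLogic L) :
    IsTenseLogic (⋂₀ S) where
  taut φ hφ L hL := (hS L hL).taut φ hφ
  adj φ ψ := forall₂_congr fun L hL => (hS L hL).adj φ ψ
  mp φ ψ h₁ h₂ L hL := (hS L hL).mp φ ψ (h₁ L hL) (h₂ L hL)
  subst φ s hφ L hL := (hS L hL).subst φ s (hφ L hL)

theorem isTenseLogic_oplus (L S : Set Formula) : IsTenseLogic (oplus L S) :=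
  isTenseLogic_sInter fun _ h => h.1

theorem subset_oplus (L S : Set Formula) : L ∪ S ⊆ oplus L S :=
  Set.subset_sInter fun _ h => h.2

theorem oplus_subset {L S L' : Set Formula} (h : IsTenseLogic L') (hL : L ⊆ L') (hS : S ⊆ L') :
    oplus L S ⊆ L' :=
  Set.sInter_subset_of_mem ⟨h, Set.union_subset hL hS⟩

theorem isTenseLogic_K4t : IsTenseLogic K4t := isTenseLogic_oplus _ _

theorem axiom4_mem_K4t : axiom4 ∈ K4t := subset_oplus _ _ (Or.inr rfl)

theorem K4t_subset {L : Set Formula} (h : IsTenseLogic L) (h4 : axiom4 ∈ L) : K4t ⊆ L :=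
  oplus_subset h (Set.sInter_subset_of_mem h) (Set.singleton_subset_iff.2 h4)

theorem box_box_mem {L : Set Formula} (h : L ∈ NExt K4t) (a : Formula) :
    .imp (.box a) (.box (.box a)) ∈ L :=
  h.1.subst axiom4 (fun _ => a) (h.2 axiom4_mem_K4t)

theorem pdia_pdia_mem {L : Set Formula} (h : L ∈ NExt K4t) (a : Formula) :
    .imp (.pdia (.pdia a)) (.pdia a) ∈ L :=
  (h.1.adj _ _).2 ((h.1.adj _ _).2 (h.1.imp_trans (h.1.box_pdia a) (box_box_mem h _)))

/-! ### Maximal consistent sets -/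

/-- `Γ` is a maximal consistent set over the logic `L`. -/
structure IsMCS (L Γ : Set Formula) : Prop where
  sub : L ⊆ Γ
  mp : ∀ a b, a ∈ Γ → Formula.imp a b ∈ Γ → b ∈ Γ
  bot : Formula.bot ∉ Γ
  complete : ∀ a, a ∈ Γ ∨ neg a ∈ Γ

theorem exists_isMCS {L Γ : Set Formula} (h : IsTenseLogic L) (hL : L ⊆ Γ)
    (hmp : ∀ a b, a ∈ Γ → Formula.imp a b ∈ Γ → b ∈ Γ) {χ : Formula} (hχ : χ ∉ Γ) :
    ∃ Δ, IsMCS L Δ ∧ Γ ⊆ Δ ∧ χ ∉ Δ := by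
  obtain ⟨Δ, hΓΔ, hΔ⟩ := zorn_subset_nonempty
    {Δ : Set Formula | L ⊆ Δ ∧ (∀ a b, a ∈ Δ → Formula.imp a b ∈ Δ → b ∈ Δ) ∧ χ ∉ Δ}
    (by
      intro c hc hchain hne
      refine ⟨⋃₀ c, ⟨?_, ?_, ?_⟩, fun s hs => Set.subset_sUnion_of_mem hs⟩
      · obtain ⟨s, hs⟩ := hne
        exact (hc hs).1.trans (Set.subset_sUnion_of_mem hs)
      · rintro a b ⟨s, hs, ha⟩ ⟨t, ht, hab⟩
        rcases hchain.total hs ht with hst | hst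
        · exact ⟨t, ht, (hc ht).2.1 a b (hst ha) hab⟩
        · exact ⟨s, hs, (hc hs).2.1 a b ha (hst hab)⟩
      · rintro ⟨s, hs, hx⟩
        exact (hc hs).2.2 hx) Γ ⟨hL, hmp, hχ⟩
  obtain ⟨hLΔ, hmpΔ, hχΔ⟩ := hΔ.prop
  have key : ∀ a, a ∉ Δ → Formula.imp a χ ∈ Δ := by
    intro a ha
    by_contra hcon
    have hsub : Δ ⊆ {b | Formula.imp a b ∈ Δ} := fun b hb =>
      hmpΔ _ _ hb (hLΔ (h.taut _ (by intro e hb hi; simp only [hi]; tauto)))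
    have := hΔ.le_of_ge (y := {b | Formula.imp a b ∈ Δ})
      ⟨hLΔ.trans hsub, fun b c hb hbc => hmpΔ _ _ hbc (hmpΔ _ _ hb (hLΔ (h.taut _ (by
        intro e hb hi; simp only [hi]; tauto)))), hcon⟩ hsub
    exact ha (this (hLΔ (h.taut _ (by intro e hb hi; simp only [hi]; tauto))))
  refine ⟨Δ, ⟨hLΔ, hmpΔ, fun hb => hχΔ ?_, fun a => ?_⟩, hΓΔ, hχΔ⟩
  · exact hmpΔ _ _ hb (hLΔ (h.taut _ (by intro e hb hi; simp only [hi]; tauto)))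
  · by_contra! hcon
    exact hχΔ (hmpΔ _ _ (key _ hcon.2) (hmpΔ _ _ (key _ hcon.1) (hLΔ (h.taut _ (by
      intro e hb hi; simp only [neg, hi]; tauto)))))

theorem exists_isMCS_not_mem {L : Set Formula} (h : IsTenseLogic L) {χ : Formula} (hχ : χ ∉ L) :
    ∃ Δ, IsMCS L Δ ∧ χ ∉ Δ := by
  obtain ⟨Δ, h1, -, h2⟩ := exists_isMCS h subset_rfl h.mp hχ
  exact ⟨Δ, h1, h2⟩

namespace IsMCS

variable {L Γ : Set Formula} (hΓ : IsMCS L Γ)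
include hΓ

theorem mem_imp {a b : Formula} (h : IsTenseLogic L) :
    Formula.imp a b ∈ Γ ↔ (a ∈ Γ → b ∈ Γ) := by
  refine ⟨fun hab ha => hΓ.mp _ _ ha hab, fun hab => ?_⟩
  rcases hΓ.complete a with ha | ha
  · exact hΓ.mp _ _ (hab ha) (hΓ.sub (h.taut _ (by intro e hb hi; simp only [hi]; tauto)))
  · exact hΓ.mp _ _ ha (hΓ.sub (h.taut _ (by intro e hb hi; simp only [neg, hi]; tauto)))

theorem mem_neg {a : Formula} (h : IsTenseLogic L) : neg a ∈ Γ ↔ a ∉ Γ :=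
  (hΓ.mem_imp h).trans (by simp [hΓ.bot])

theorem mem_conj {a b : Formula} (h : IsTenseLogic L) : conj a b ∈ Γ ↔ a ∈ Γ ∧ b ∈ Γ := by
  rw [conj, hΓ.mem_neg h, hΓ.mem_imp h, hΓ.mem_neg h]; tauto

theorem of_imp_mem {a b : Formula} (hab : Formula.imp a b ∈ L) (ha : a ∈ Γ) : b ∈ Γ :=
  hΓ.mp _ _ ha (hΓ.sub hab)

theorem exists_succ (h : IsTenseLogic L) {a : Formula} (ha : Formula.box a ∉ Γ) :
    ∃ Δ, IsMCS L Δ ∧ (∀ b, Formula.box b ∈ Γ → b ∈ Δ) ∧ a ∉ Δ :=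
  exists_isMCS (Γ := {b | Formula.box b ∈ Γ}) h (fun _ hb => hΓ.sub (h.box_mem hb))
    (fun a b ha hab => hΓ.mp _ _ ha (hΓ.of_imp_mem (h.box_imp a b) hab)) ha

theorem exists_pred (h : IsTenseLogic L) {a : Formula} (ha : Formula.pdia a ∈ Γ) :
    ∃ Δ, IsMCS L Δ ∧ (∀ b, Formula.box b ∈ Δ → b ∈ Γ) ∧ a ∈ Δ := by
  have hnn : ∀ b, Formula.imp b (neg (neg b)) ∈ L := fun b =>
    h.taut _ (by intro e hb hi; simp only [neg, hi]; tauto)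
  obtain ⟨Δ, hΔ, hsub, hna⟩ := exists_isMCS (Γ := {b | hist b ∈ Γ}) h
    (fun _ hb => hΓ.sub (h.hist_mem hb)) (fun b c hb hbc => by
      simp only [Set.mem_ofPred_eq, hist, hΓ.mem_neg h] at hb hbc ⊢
      intro hc
      have h1 := hΓ.of_imp_mem (h.pdia_mono (b := .imp (neg (neg b)) (neg (.imp b c)))
        (h.taut _ (by intro e hb hi; simp only [neg, hi]; tauto))) hc
      have h2 := hΓ.of_imp_mem (h.pdia_or _ _) h1
      rw [hΓ.mem_imp h, hΓ.mem_neg h] at h2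
      exact hbc (h2 hb))
    (χ := neg a) (by
      simp only [Set.mem_ofPred_eq, hist, hΓ.mem_neg h, not_not]
      exact hΓ.of_imp_mem (h.pdia_mono (hnn a)) ha)
  refine ⟨Δ, hΔ, fun b hb => ?_, ?_⟩
  · by_contra hbΓ
    have : neg (.box b) ∈ Δ := hsub (by
      simp only [Set.mem_ofPred_eq, hist, hΓ.mem_neg h]
      intro hcon
      exact hbΓ (hΓ.of_imp_mem (h.imp_trans (h.pdia_mono (h.taut _ (by
        intro e hb hi; simp only [neg, hi]; tauto))) (h.pdia_box b)) hcon))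
    exact (hΔ.mem_neg h).1 this hb
  · by_contra haΔ
    exact hna ((hΔ.mem_neg h).2 haΔ)

theorem pdia_mem_of_succ (h : IsTenseLogic L) {Δ : Set Formula}
    (hR : ∀ b, Formula.box b ∈ Γ → b ∈ Δ) {a : Formula} (ha : a ∈ Γ) : Formula.pdia a ∈ Δ :=
  hR _ (hΓ.of_imp_mem (h.box_pdia a) ha)

end IsMCS

/-! ### Semantics of the derived connectives -/

section Semantics

variable (F : Frame.{u}) (V : ℕ → Set F.carrier) (x : F.carrier) (a b : Formula)

theorem mem_val_imp : x ∈ F.val V (.imp a b) ↔ (x ∈ F.val V a → x ∈ F.val V b) := by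
  simp only [Frame.val, Set.mem_union, Set.mem_compl_iff]; tauto

theorem mem_val_bot : x ∈ F.val V .bot ↔ False := Iff.rfl

theorem mem_val_neg : x ∈ F.val V (neg a) ↔ x ∉ F.val V a := mem_val_imp F V x a .bot

theorem mem_val_conj : x ∈ F.val V (conj a b) ↔ x ∈ F.val V a ∧ x ∈ F.val V b := by
  rw [conj, mem_val_neg, mem_val_imp, mem_val_neg]; tauto

theorem mem_val_box : x ∈ F.val V (.box a) ↔ ∀ y, F.rel x y → y ∈ F.val V a := Iff.rfl

theorem mem_val_pdia : x ∈ F.val V (.pdia a) ↔ ∃ y ∈ F.val V a, F.rel y x := Iff.rfl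

theorem mem_val_dia : x ∈ F.val V (dia a) ↔ ∃ y, F.rel x y ∧ y ∈ F.val V a := by
  rw [dia, mem_val_neg, mem_val_box]; simp only [mem_val_neg]; push Not; rfl

theorem mem_val_hist : x ∈ F.val V (hist a) ↔ ∀ y, F.rel y x → y ∈ F.val V a := by
  rw [hist, mem_val_neg, mem_val_pdia]; simp only [mem_val_neg]; push Not
  exact forall_congr' fun y => by tauto

theorem mem_val_isolated :
    x ∈ F.val V isolated ↔ (∀ y, ¬ F.rel x y) ∧ ∀ y, ¬ F.rel y x := by
  simp only [isolated, mem_val_conj, mem_val_neg, mem_val_box, mem_val_pdia, mem_val_bot]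
  simp

theorem val_subst (s : ℕ → Formula) :
    F.val V (a.subst s) = F.val (fun i => F.val V (s i)) a := by
  induction a with
  | var i => rfl
  | bot => rfl
  | imp a b iha ihb => simp only [Formula.subst, Frame.val, iha, ihb]
  | box a ih => simp only [Formula.subst, Frame.val, ih]
  | pdia a ih => simp only [Formula.subst, Frame.val, ih]

end Semantics

/-- The formulas valid in `F` under all valuations by members of `P`. -/
def genLog (F : Frame.{u}) (P : Set (Set F.carrier)) : Set Formula :=
  {φ | ∀ V : ℕ → Set F.carrier, (∀ i, V i ∈ P) → ∀ x, x ∈ F.val V φ}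

/-- `P` is closed under the operations interpreting the connectives. -/
structure IsTenseAlgebra (F : Frame.{u}) (P : Set (Set F.carrier)) : Prop where
  bot : ∅ ∈ P
  imp : ∀ A ∈ P, ∀ B ∈ P, Aᶜ ∪ B ∈ P
  box : ∀ A ∈ P, {x | ∀ y, F.rel x y → y ∈ A} ∈ P
  pdia : ∀ A ∈ P, {y | ∃ x ∈ A, F.rel x y} ∈ P

theorem IsTenseAlgebra.val_mem {F : Frame.{u}} {P : Set (Set F.carrier)}
    (hP : IsTenseAlgebra F P) {V : ℕ → Set F.carrier} (hV : ∀ i, V i ∈ P) (φ : Formula) :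
    F.val V φ ∈ P := by
  induction φ with
  | var i => exact hV i
  | bot => exact hP.bot
  | imp a b iha ihb => exact hP.imp _ iha _ ihb
  | box a ih => exact hP.box _ ih
  | pdia a ih => exact hP.pdia _ ih

theorem IsTenseAlgebra.isTenseLogic {F : Frame.{u}} {P : Set (Set F.carrier)}
    (hP : IsTenseAlgebra F P) : IsTenseLogic (genLog F P) where
  taut φ hφ V _ x := hφ (fun ψ => x ∈ F.val V ψ) (fun h => h) (fun a b => mem_val_imp F V x a b)
  adj φ ψ := by
    refine forall₂_congr fun V _ => ?_
    simp only [mem_val_imp, mem_val_pdia, mem_val_box]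
    exact ⟨fun h x hx y hxy => h y ⟨x, hx, hxy⟩, fun h y ⟨x, hx, hxy⟩ => h x hx y hxy⟩
  mp φ ψ h₁ h₂ V hV x := (mem_val_imp F V x φ ψ).1 (h₂ V hV x) (h₁ V hV x)
  subst φ s h V hV x := by
    rw [val_subst]
    exact h _ (fun i => hP.val_mem hV (s i)) x

theorem axiom4_mem_genLog {F : Frame.{u}} {P : Set (Set F.carrier)}
    (hF : ∀ x y z, F.rel x y → F.rel y z → F.rel x z) : axiom4 ∈ genLog F P := by
  intro V _ x
  rw [axiom4, mem_val_imp]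
  exact fun h y hxy z hyz => h z (hF x y z hxy hyz)

theorem IsTenseAlgebra.genLog_mem_NExt {F : Frame.{u}} {P : Set (Set F.carrier)}
    (hP : IsTenseAlgebra F P) (hF : ∀ x y z, F.rel x y → F.rel y z → F.rel x z) :
    genLog F P ∈ NExt K4t :=
  ⟨hP.isTenseLogic, K4t_subset hP.isTenseLogic (axiom4_mem_genLog hF)⟩

/-! ### The splitting by `•` -/

/-- The logic axiomatised over `K4_t` by the absence of isolated points. -/
def splitLogic : Set Formula := oplus K4t {neg isolated}

theorem isTenseLogic_splitLogic : IsTenseLogic splitLogic := isTenseLogic_oplus _ _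

theorem splitLogic_mem_NExt : splitLogic ∈ NExt K4t :=
  ⟨isTenseLogic_splitLogic, Set.subset_union_left.trans (subset_oplus _ _)⟩

theorem neg_isolated_mem_splitLogic : neg isolated ∈ splitLogic := subset_oplus _ _ (Or.inr rfl)

theorem log_bullet_mem_NExt : Log {bullet} ∈ NExt K4t := by
  have : Log {bullet} = genLog bullet Set.univ := by
    ext φ
    simp [Log, genLog, Frame.Valid]
  rw [this]
  exact IsTenseAlgebra.genLog_mem_NExt ⟨trivial, by simp, by simp, by simp⟩
    (fun _ _ _ h => h.elim)

theorem Formula.subst_var (φ : Formula) : φ.subst .var = φ := by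
  induction φ <;> simp_all [Formula.subst]

theorem IsMCS.subst_mem_iff {L Γ : Set Formula} (h : IsTenseLogic L) (hΓ : IsMCS L Γ)
    (hι : isolated ∈ Γ) (s : ℕ → Formula) (φ : Formula) (x : bullet.carrier) :
    φ.subst s ∈ Γ ↔ x ∈ bullet.val (fun i => {_u | s i ∈ Γ}) φ := by
  obtain ⟨h1, h2⟩ := (hΓ.mem_conj h).1 hι
  rw [hΓ.mem_neg h] at h2
  induction φ with
  | var i => rfl
  | bot => exact iff_of_false hΓ.bot (fun h => h)
  | imp a b iha ihb => rw [Formula.subst, hΓ.mem_imp h, mem_val_imp, iha, ihb]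
  | box a ih =>
    refine iff_of_true (hΓ.of_imp_mem (h.box_mono (h.taut _ ?_)) h1) (fun _ hr => hr.elim)
    intro e hb hi; simp only [hi]; tauto
  | pdia a ih =>
    refine iff_of_false (fun hc => h2 (hΓ.of_imp_mem (h.pdia_mono (h.taut _ ?_)) hc))
      (fun ⟨_, _, hr⟩ => hr)
    intro e hb hi; simp only [neg, hi]; tauto

theorem neg_isolated_mem {L : Set Formula} (h : IsTenseLogic L) (hL : ¬ L ⊆ Log {bullet}) :
    neg isolated ∈ L := by
  classical
  obtain ⟨φ, hφ, hn⟩ := Set.not_subset.1 hL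
  simp only [Log, Set.mem_ofPred_eq, Set.mem_singleton_iff, forall_eq, Frame.Valid, not_forall] at hn
  obtain ⟨V, x, hx⟩ := hn
  by_contra hι
  obtain ⟨Γ, hΓ, hιΓ⟩ := exists_isMCS_not_mem h hι
  rw [hΓ.mem_neg h, not_not] at hιΓ
  have h1 := (hΓ.subst_mem_iff h hιΓ (fun i => if x ∈ V i then neg .bot else .bot) φ x).1
    (hΓ.sub (h.subst _ _ hφ))
  have h2 : (fun i => {_u : bullet.carrier | (if x ∈ V i then neg .bot else .bot) ∈ Γ}) = V := by
    funext i
    ext u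
    obtain rfl : u = x := rfl
    by_cases hu : u ∈ V i
    · simp [hu, hΓ.mem_neg h, hΓ.bot]
    · simp [hu, hΓ.bot]
  rw [h2] at h1
  exact hx h1

theorem isSplittingPair_splitLogic : IsSplittingPair K4t (Log {bullet}) splitLogic := by
  refine ⟨log_bullet_mem_NExt, splitLogic_mem_NExt, fun L hL => ?_⟩
  by_cases h : L ⊆ Log {bullet}
  · refine Or.inl ⟨h, fun hs => ?_⟩
    obtain ⟨x⟩ := bullet.nonempty
    have := h (hs neg_isolated_mem_splitLogic) bullet rfl (fun _ => ∅) x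
    rw [mem_val_neg, mem_val_isolated] at this
    exact this ⟨fun _ h => h, fun _ h => h⟩
  · exact Or.inr ⟨oplus_subset hL.1 hL.2 (Set.singleton_subset_iff.2 (neg_isolated_mem hL.1 h)), h⟩

theorem IsSplittingPair.subset {L₀ L₁ L₂ L₂' : Set Formula} (h : IsSplittingPair L₀ L₁ L₂)
    (h' : IsSplittingPair L₀ L₁ L₂') : L₂' ⊆ L₂ := by
  have h1 := h.2.2 L₂ h.2.1
  have h2 := h'.2.2 L₂ h.2.1
  rcases h1 with ⟨-, h1⟩ | ⟨-, h1⟩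
  · exact absurd subset_rfl h1
  · rcases h2 with ⟨h2, -⟩ | ⟨h2, -⟩
    · exact absurd h2 h1
    · exact h2

theorem IsSplittingPair.unique {L₀ L₁ L₂ L₂' : Set Formula} (h : IsSplittingPair L₀ L₁ L₂)
    (h' : IsSplittingPair L₀ L₁ L₂') : L₂' = L₂ :=
  (h.subset h').antisymm (h'.subset h)

theorem imp_mem_of_mem_splitLogic {φ : Formula} (hφ : φ ∈ splitLogic) :
    .imp (neg isolated) φ ∈ K4t := by
  have h := isTenseLogic_K4t
  have key : splitLogic ⊆ {φ | .imp (neg isolated) φ ∈ K4t} := by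
    refine oplus_subset ⟨fun a ha => ?_, fun a b => ?_, fun a b ha hab => ?_, fun a s ha => ?_⟩
      (fun a ha => h.mp _ _ ha (h.taut _ ?_)) (Set.singleton_subset_iff.2 (h.taut _ ?_))
    · exact h.mp _ _ (h.taut a ha) (h.taut _ (by intro e hb hi; simp only [hi]; tauto))
    · have h1 : .imp (.pdia a) (neg isolated) ∈ K4t := by
        have : .imp (.pdia a) (.pdia (neg .bot)) ∈ K4t :=
          h.pdia_mono (h.taut _ (by intro e hb hi; simp only [neg, hi]; tauto))
        exact h.mp _ _ this (h.taut _ (by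
          intro e hb hi; simp only [isolated, conj, neg, hi]; tauto))
      have h2 : .imp isolated (.box b) ∈ K4t := by
        have : .imp (.box .bot) (.box b) ∈ K4t :=
          h.box_mono (h.taut _ (by intro e hb hi; simp only [hi]; tauto))
        exact h.mp _ _ this (h.taut _ (by
          intro e hb hi; simp only [isolated, conj, neg, hi]; tauto))
      constructor
      · intro hab
        have h3 : .imp (.pdia a) b ∈ K4t := h.mp _ _ hab (h.mp _ _ h1 (h.taut _ (by
          intro e hb hi; simp only [hi]; tauto)))
        exact h.mp _ _ ((h.adj _ _).1 h3) (h.taut _ (by intro e hb hi; simp only [hi]; tauto))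
      · intro hab
        have h3 : .imp a (.box b) ∈ K4t := h.mp _ _ hab (h.mp _ _ h2 (h.taut _ (by
          intro e hb hi; simp only [neg, hi]; tauto)))
        exact h.mp _ _ ((h.adj _ _).2 h3) (h.taut _ (by intro e hb hi; simp only [hi]; tauto))
    · exact h.mp _ _ hab (h.mp _ _ ha (h.taut _ (by intro e hb hi; simp only [hi]; tauto)))
    · exact h.subst _ s ha
    · intro e hb hi; simp only [hi]; tauto
    · intro e hb hi; simp only [hi]; tauto
  exact key hφ

theorem mem_K4t_of_mem_splitLogic {φ : Formula} (hφ : φ ∈ splitLogic) (hb : φ ∈ Log {bullet}) :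
    φ ∈ K4t := by
  have h := isTenseLogic_K4t
  by_contra hn
  obtain ⟨Γ, hΓ, hφΓ⟩ := exists_isMCS_not_mem h hn
  by_cases hι : isolated ∈ Γ
  · have := hΓ.subst_mem_iff h hι .var φ ()
    rw [Formula.subst_var] at this
    exact hφΓ (this.2 (hb bullet rfl _ _))
  · exact hφΓ (hΓ.of_imp_mem (imp_mem_of_mem_splitLogic hφ) ((hΓ.mem_neg h).2 hι))

theorem exists_mem_not_mem_splitLogic {L : Set Formula} (hL : L ∈ NExt K4t) (h1 : L ≠ K4t)
    (h2 : L ≠ splitLogic) : ∃ φ ∈ L, φ ∉ splitLogic := by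
  by_contra! hcon
  rcases isSplittingPair_splitLogic.2.2 L hL with ⟨h, -⟩ | ⟨h, -⟩
  · exact h1 (Set.Subset.antisymm (fun φ hφ => mem_K4t_of_mem_splitLogic (hcon φ hφ) (h hφ)) hL.2)
  · exact h2 (Set.Subset.antisymm hcon h)

/-! ### Finite model property -/

/-- The set of subformulas. -/
def Formula.sub : Formula → Set Formula
  | .var i => {.var i}
  | .bot => {.bot}
  | .imp a b => {.imp a b} ∪ a.sub ∪ b.sub
  | .box a => {.box a} ∪ a.sub
  | .pdia a => {.pdia a} ∪ a.sub

theorem Formula.finite_sub (φ : Formula) : φ.sub.Finite := by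
  induction φ <;> simp_all [Formula.sub]

theorem Formula.mem_sub_self (φ : Formula) : φ ∈ φ.sub := by
  cases φ <;> simp [Formula.sub]

/-- A set of formulas closed under immediate subformulas. -/
structure SubClosed (S : Set Formula) : Prop where
  imp : ∀ a b, Formula.imp a b ∈ S → a ∈ S ∧ b ∈ S
  box : ∀ a, Formula.box a ∈ S → a ∈ S
  pdia : ∀ a, Formula.pdia a ∈ S → a ∈ S

theorem SubClosed.union {S T : Set Formula} (hS : SubClosed S) (hT : SubClosed T) :
    SubClosed (S ∪ T) where
  imp a b h := h.elim (fun h => ⟨.inl (hS.imp a b h).1, .inl (hS.imp a b h).2⟩)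
    (fun h => ⟨.inr (hT.imp a b h).1, .inr (hT.imp a b h).2⟩)
  box a h := h.imp (hS.box a) (hT.box a)
  pdia a h := h.imp (hS.pdia a) (hT.pdia a)

theorem Formula.subClosed_sub (φ : Formula) : SubClosed φ.sub := by
  induction φ with
  | var i => constructor <;> simp [Formula.sub]
  | bot => constructor <;> simp [Formula.sub]
  | imp a b iha ihb =>
    have h := iha.union ihb
    have ha := a.mem_sub_self
    have hb := b.mem_sub_self
    simp only [Formula.sub, Set.union_assoc]
    constructor
    · rintro c d (hc | hc)
      · cases hc; exact ⟨.inr (.inl ha), .inr (.inr hb)⟩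
      · exact ⟨.inr (h.imp c d hc).1, .inr (h.imp c d hc).2⟩
    · rintro c (hc | hc)
      · cases hc
      · exact .inr (h.box c hc)
    · rintro c (hc | hc)
      · cases hc
      · exact .inr (h.pdia c hc)
  | box a h =>
    have ha := a.mem_sub_self
    simp only [Formula.sub]
    constructor
    · rintro c d (hc | hc)
      · cases hc
      · exact ⟨.inr (h.imp c d hc).1, .inr (h.imp c d hc).2⟩
    · rintro c (hc | hc)
      · cases hc; exact .inr ha
      · exact .inr (h.box c hc)
    · rintro c (hc | hc)
      · cases hc
      · exact .inr (h.pdia c hc)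
  | pdia a h =>
    have ha := a.mem_sub_self
    simp only [Formula.sub]
    constructor
    · rintro c d (hc | hc)
      · cases hc
      · exact ⟨.inr (h.imp c d hc).1, .inr (h.imp c d hc).2⟩
    · rintro c (hc | hc)
      · cases hc
      · exact .inr (h.box c hc)
    · rintro c (hc | hc)
      · cases hc; exact .inr ha
      · exact .inr (h.pdia c hc)

/-- The transitive filtration of the canonical model of `L` through `S`, on traces of maximal
consistent sets. -/
def filtration (L S : Set Formula) (hne : ∃ Γ, IsMCS L Γ) : Frame.{0} where
  carrier := {A : Set Formula // ∃ Γ, IsMCS L Γ ∧ A = Γ ∩ S}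
  nonempty := hne.elim fun Γ hΓ => ⟨⟨Γ ∩ S, Γ, hΓ, rfl⟩⟩
  rel A B := (∀ a, Formula.box a ∈ A.1 → a ∈ B.1 ∧ Formula.box a ∈ B.1) ∧
    ∀ a, Formula.pdia a ∈ S → a ∈ A.1 ∨ Formula.pdia a ∈ A.1 → Formula.pdia a ∈ B.1

theorem filtration_trans {L S : Set Formula} (hne : ∃ Γ, IsMCS L Γ)
    (A B C : (filtration L S hne).carrier) (hAB : (filtration L S hne).rel A B)
    (hBC : (filtration L S hne).rel B C) : (filtration L S hne).rel A C :=
  ⟨fun a ha => hBC.1 a (hAB.1 a ha).2, fun a hS ha => hBC.2 a hS (.inr (hAB.2 a hS ha))⟩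

theorem filtration_rel {L S : Set Formula} (hne : ∃ Γ, IsMCS L Γ) (hL : L ∈ NExt K4t)
    (hS : SubClosed S) {Γ Δ : Set Formula} (hΓ : IsMCS L Γ) (hΔ : IsMCS L Δ)
    (hR : ∀ b, Formula.box b ∈ Γ → b ∈ Δ) :
    (filtration L S hne).rel ⟨Γ ∩ S, Γ, hΓ, rfl⟩ ⟨Δ ∩ S, Δ, hΔ, rfl⟩ := by
  refine ⟨fun a ha => ⟨⟨hR a ha.1, hS.box a ha.2⟩,
    ⟨hR _ (hΓ.of_imp_mem (box_box_mem hL a) ha.1), ha.2⟩⟩, ?_⟩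
  rintro a haS (ha | ha)
  · exact ⟨hΓ.pdia_mem_of_succ hL.1 hR ha.1, haS⟩
  · exact ⟨hΔ.of_imp_mem (pdia_pdia_mem hL a) (hΓ.pdia_mem_of_succ hL.1 hR ha.1), haS⟩

/-- The canonical valuation on a filtration. -/
def filtrationVal (L S : Set Formula) (hne : ∃ Γ, IsMCS L Γ) (i : ℕ) :
    Set (filtration L S hne).carrier :=
  {A | Formula.var i ∈ A.1}

theorem filtration_truth {L S : Set Formula} (hne : ∃ Γ, IsMCS L Γ) (hL : L ∈ NExt K4t)
    (hS : SubClosed S) (φ : Formula) (hφ : φ ∈ S) (A : (filtration L S hne).carrier) :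
    A ∈ (filtration L S hne).val (filtrationVal L S hne) φ ↔ φ ∈ A.1 := by
  induction φ generalizing A with
  | var i => rfl
  | bot =>
    obtain ⟨_, Γ, hΓ, rfl⟩ := A
    exact iff_of_false (fun h => h) (fun h => hΓ.bot h.1)
  | imp a b iha ihb =>
    obtain ⟨ha, hb⟩ := hS.imp a b hφ
    rw [mem_val_imp, iha ha, ihb hb]
    obtain ⟨_, Γ, hΓ, rfl⟩ := A
    simp only [Set.mem_inter_iff, hΓ.mem_imp hL.1, ha, hb, hφ, and_true]
  | box a ih =>
    have ha := hS.box a hφ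
    rw [mem_val_box]
    constructor
    · intro h
      obtain ⟨_, Γ, hΓ, rfl⟩ := A
      refine ⟨?_, hφ⟩
      by_contra hn
      obtain ⟨Δ, hΔ, hR, haΔ⟩ := hΓ.exists_succ hL.1 hn
      exact haΔ ((ih ha _).1 (h _ (filtration_rel hne hL hS hΓ hΔ hR))).1
    · exact fun h B hAB => (ih ha B).2 (hAB.1 a h).1
  | pdia a ih =>
    have ha := hS.pdia a hφ
    rw [mem_val_pdia]
    constructor
    · rintro ⟨B, hB, hBA⟩
      exact hBA.2 a hφ (.inl ((ih ha B).1 hB))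
    · intro h
      obtain ⟨_, Γ, hΓ, rfl⟩ := A
      obtain ⟨Δ, hΔ, hR, haΔ⟩ := hΓ.exists_pred hL.1 h.1
      exact ⟨_, (ih ha ⟨Δ ∩ S, Δ, hΔ, rfl⟩).2 ⟨haΔ, ha⟩, filtration_rel hne hL hS hΔ hΓ hR⟩

theorem exists_finite_frame {φ : Formula} (hφ : φ ∉ splitLogic) :
    ∃ (M : Frame.{0}) (V : ℕ → Set M.carrier) (x : M.carrier), Finite M.carrier ∧
      (∀ x y z, M.rel x y → M.rel y z → M.rel x z) ∧ (∀ x, ∃ y, M.rel x y ∨ M.rel y x) ∧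
      x ∉ M.val V φ := by
  have hL := splitLogic_mem_NExt
  obtain ⟨Γ, hΓ, hφΓ⟩ := exists_isMCS_not_mem hL.1 hφ
  have hne : ∃ Γ, IsMCS splitLogic Γ := ⟨Γ, hΓ⟩
  have hS := φ.subClosed_sub
  refine ⟨filtration splitLogic φ.sub hne, filtrationVal _ _ hne,
    ⟨Γ ∩ φ.sub, Γ, hΓ, rfl⟩, ?_, filtration_trans hne, ?_, ?_⟩
  · refine (φ.finite_sub.finite_subsets.subset (s := φ.sub.powerset) ?_).to_subtype
    rintro _ ⟨Δ, -, rfl⟩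
    exact Set.inter_subset_right
  · rintro ⟨_, Δ, hΔ, rfl⟩
    have := hΔ.sub neg_isolated_mem_splitLogic
    rw [hΔ.mem_neg hL.1, isolated, hΔ.mem_conj hL.1, hΔ.mem_neg hL.1] at this
    by_cases hb : Formula.box .bot ∈ Δ
    · obtain ⟨Θ, hΘ, hR, -⟩ := hΔ.exists_pred hL.1 (not_not.1 fun h => this ⟨hb, h⟩)
      exact ⟨_, .inr (filtration_rel hne hL hS hΘ hΔ hR)⟩
    · obtain ⟨Θ, hΘ, hR, -⟩ := hΔ.exists_succ hL.1 hb
      exact ⟨_, .inl (filtration_rel hne hL hS hΔ hΘ hR)⟩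
  · exact fun h => hφΓ ((filtration_truth hne hL hS φ φ.mem_sub_self _).1 h).1

/-! ### Reachability and rank -/

/-- `y` is reachable from `x` by at most `m` steps along the relation or its inverse. -/
def Frame.Near (F : Frame.{u}) : ℕ → F.carrier → F.carrier → Prop
  | 0, x, y => x = y
  | m + 1, x, y => ∃ z, (x = z ∨ F.rel x z ∨ F.rel z x) ∧ F.Near m z y

theorem Frame.Near.trans {F : Frame.{u}} {m n : ℕ} {x y z : F.carrier} (h : F.Near m x y)
    (h' : F.Near n y z) : F.Near (m + n) x z := by
  induction m generalizing x with
  | zero => obtain rfl : x = y := h; simpa using h'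
  | succ m ih =>
    obtain ⟨w, hw, hwy⟩ := h
    rw [Nat.add_right_comm]
    exact ⟨w, hw, ih hwy⟩

theorem Frame.Near.mono {F : Frame.{u}} {m n : ℕ} {x y : F.carrier} (h : F.Near m x y)
    (hmn : m ≤ n) : F.Near n x y := by
  have key : ∀ k, F.Near k y y := fun k => by
    induction k with
    | zero => rfl
    | succ k ih => exact ⟨y, .inl rfl, ih⟩
  simpa [Nat.add_sub_cancel' hmn] using h.trans (key (n - m))

theorem Frame.Near.succ {F : Frame.{u}} {x y : F.carrier} (h : F.rel x y) : F.Near 1 x y :=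
  ⟨y, .inr (.inl h), rfl⟩

theorem Frame.Near.pred {F : Frame.{u}} {x y : F.carrier} (h : F.rel y x) : F.Near 1 x y :=
  ⟨y, .inr (.inr h), rfl⟩

/-- The formula expressing that `φ` holds at a point reachable by at most `m` steps. -/
def reach : ℕ → Formula → Formula
  | 0, φ => φ
  | m + 1, φ => .imp (neg (reach m φ)) (.imp (neg (dia (reach m φ))) (.pdia (reach m φ)))

theorem mem_val_reach (F : Frame.{u}) (V : ℕ → Set F.carrier) (m : ℕ) (φ : Formula)
    (x : F.carrier) : x ∈ F.val V (reach m φ) ↔ ∃ y, F.Near m x y ∧ y ∈ F.val V φ := by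
  induction m generalizing x with
  | zero => simp [reach, Frame.Near]
  | succ m ih =>
    simp only [reach, mem_val_imp, mem_val_neg, mem_val_dia, mem_val_pdia, ih, Frame.Near]
    constructor
    · intro h
      by_cases h1 : ∃ y, F.Near m x y ∧ y ∈ F.val V φ
      · obtain ⟨y, hy, hyφ⟩ := h1
        exact ⟨y, ⟨x, .inl rfl, hy⟩, hyφ⟩
      by_cases h2 : ∃ z, F.rel x z ∧ ∃ y, F.Near m z y ∧ y ∈ F.val V φ
      · obtain ⟨z, hz, y, hy, hyφ⟩ := h2
        exact ⟨y, ⟨z, .inr (.inl hz), hy⟩, hyφ⟩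
      obtain ⟨z, ⟨y, hy, hyφ⟩, hz⟩ := h h1 h2
      exact ⟨y, ⟨z, .inr (.inr hz), hy⟩, hyφ⟩
    · rintro ⟨y, ⟨z, rfl | hz | hz, hy⟩, hyφ⟩ h1 h2
      · exact absurd ⟨y, hy, hyφ⟩ h1
      · exact absurd ⟨z, hz, y, hy, hyφ⟩ h2
      · exact ⟨z, ⟨y, hy, hyφ⟩, hz⟩

/-- There is a path of length `j` starting from `x`. -/
def Frame.HasPath (F : Frame.{u}) : ℕ → F.carrier → Prop
  | 0, _ => True
  | j + 1, x => ∃ y, F.rel x y ∧ F.HasPath j y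

theorem Frame.HasPath.mono {F : Frame.{u}} {i j : ℕ} {x : F.carrier} (h : F.HasPath j x)
    (hij : i ≤ j) : F.HasPath i x := by
  induction i generalizing j x with
  | zero => trivial
  | succ i ih =>
    obtain ⟨j, rfl⟩ : ∃ k, j = k + 1 := ⟨j - 1, by omega⟩
    obtain ⟨y, hxy, hy⟩ := h
    exact ⟨y, hxy, ih hy (by omega)⟩

/-- The longest path starting from `x` has length `j`. -/
def Frame.HasRank (F : Frame.{u}) (j : ℕ) (x : F.carrier) : Prop :=
  F.HasPath j x ∧ ¬ F.HasPath (j + 1) x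

theorem Frame.HasRank.unique {F : Frame.{u}} {i j : ℕ} {x : F.carrier} (hi : F.HasRank i x)
    (hj : F.HasRank j x) : i = j := by
  rcases lt_trichotomy i j with h | h | h
  · exact absurd (hj.1.mono h) hi.2
  · exact h
  · exact absurd (hi.1.mono h) hj.2

theorem Frame.HasRank.exists_succ {F : Frame.{u}} {j : ℕ} {x : F.carrier}
    (h : F.HasRank (j + 1) x) : ∃ y, F.rel x y ∧ F.HasRank j y := by
  obtain ⟨⟨y, hxy, hy⟩, hn⟩ := h
  exact ⟨y, hxy, hy, fun hy' => hn ⟨y, hxy, hy'⟩⟩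

/-- The formula `◇ʲ⊤`. -/
def pathFormula : ℕ → Formula
  | 0 => neg .bot
  | j + 1 => dia (pathFormula j)

/-- The formula `◇ʲ⊤ ∧ ¬◇ʲ⁺¹⊤`. -/
def rankFormula (j : ℕ) : Formula := conj (pathFormula j) (neg (pathFormula (j + 1)))

theorem mem_val_pathFormula (F : Frame.{u}) (V : ℕ → Set F.carrier) (j : ℕ) (x : F.carrier) :
    x ∈ F.val V (pathFormula j) ↔ F.HasPath j x := by
  induction j generalizing x with
  | zero => simp [pathFormula, mem_val_neg, mem_val_bot, Frame.HasPath]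
  | succ j ih => simp only [pathFormula, mem_val_dia, Frame.HasPath, ih]

theorem mem_val_rankFormula (F : Frame.{u}) (V : ℕ → Set F.carrier) (j : ℕ) (x : F.carrier) :
    x ∈ F.val V (rankFormula j) ↔ F.HasRank j x := by
  rw [rankFormula, mem_val_conj, mem_val_neg, mem_val_pathFormula, mem_val_pathFormula,
    Frame.HasRank]

/-! ### A set of formulas without Kripke frames -/

/-- `⧫p → ⧫¬(p → ⧫(¬p ∧ ⧫p))`: `p` does not alternate with its complement in the past. -/
def nonAlternating : Formula :=
  .imp (.pdia (.var 0)) (.pdia (neg (.imp (.var 0) (.pdia (conj (neg (.var 0)) (.pdia (.var 0)))))))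

theorem mem_val_nonAlternating (F : Frame.{u}) (V : ℕ → Set F.carrier) (x : F.carrier) :
    x ∈ F.val V nonAlternating ↔ ((∃ y ∈ V 0, F.rel y x) → ∃ y, F.rel y x ∧ y ∈ V 0 ∧
      ∀ z, F.rel z y → z ∉ V 0 → ∀ t, F.rel t z → t ∉ V 0) := by
  have hv : F.val V (.var 0) = V 0 := rfl
  simp only [nonAlternating, mem_val_imp, mem_val_pdia, mem_val_neg, mem_val_conj, hv]
  refine imp_congr_right fun _ => exists_congr fun y => ?_
  push Not
  constructor
  · rintro ⟨⟨h1, h2⟩, h3⟩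
    exact ⟨h3, h1, fun z hz hz' t ht ht' => h2 z ⟨hz', t, ht', ht⟩ hz⟩
  · rintro ⟨h3, h1, h2⟩
    exact ⟨⟨h1, fun z ⟨hz', t, ht', ht⟩ hz => h2 z hz hz' t ht ht'⟩, h3⟩

theorem exists_not_mem_val {L : Set Formula} (h : IsTenseLogic L) (N K : ℕ)
    (hreach : reach N (rankFormula K) ∈ L)
    (hnext : ∀ j, K ≤ j → .imp (rankFormula j) (.pdia (rankFormula (j + 1))) ∈ L)
    (halt : .imp (rankFormula K) nonAlternating ∈ L) (G : Frame.{u}) (x : G.carrier) :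
    ∃ ψ ∈ L, ∃ V, x ∉ G.val V ψ := by
  by_contra! hx
  let Good : G.carrier → Prop := fun y => ∀ ψ ∈ L, ∀ V, y ∈ G.val V ψ
  have hsucc : ∀ {y z}, Good y → G.rel y z → Good z := fun hy hyz ψ hψ V =>
    hy _ (h.box_mem hψ) V _ hyz
  have hpred : ∀ {y z}, Good y → G.rel z y → Good z := fun {y z} hy hyz ψ hψ V =>
    (mem_val_hist G V y ψ).1 (hy _ (h.hist_mem hψ) V) _ hyz
  have hnear : ∀ m {y z}, Good y → G.Near m y z → Good z := by
    intro m
    induction m with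
    | zero => rintro y z hy rfl; exact hy
    | succ m ih =>
      rintro y z hy ⟨w, rfl | hw | hw, hwz⟩
      · exact ih hy hwz
      · exact ih (hsucc hy hw) hwz
      · exact ih (hpred hy hw) hwz
  have hstep : ∀ {y j}, Good y → K ≤ j → G.HasRank j y → ∃ z, G.rel z y ∧ G.HasRank (j + 1) z := by
    intro y j hy hj hr
    have := hy _ (hnext j hj) (fun _ => ∅)
    rw [mem_val_imp, mem_val_pdia, mem_val_rankFormula] at this
    obtain ⟨z, hz, hzy⟩ := this hr
    exact ⟨z, hzy, (mem_val_rankFormula _ _ _ _).1 hz⟩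
  obtain ⟨y, hxy, hy⟩ := (mem_val_reach _ _ _ _ _).1 (hx _ hreach fun _ => ∅)
  have hyG : Good y := hnear N hx hxy
  have h1 := hyG _ halt (fun _ => {z | ∃ i, G.HasRank (K + 2 * i + 1) z})
  rw [mem_val_rankFormula] at hy
  rw [mem_val_imp, mem_val_rankFormula, mem_val_nonAlternating] at h1
  obtain ⟨z, hzy, hz⟩ := hstep hyG le_rfl hy
  obtain ⟨w, hwy, ⟨i, hw⟩, hall⟩ := h1 hy ⟨z, ⟨0, hz⟩, hzy⟩
  obtain ⟨s, hsw, hs⟩ := hstep (hpred hyG hwy) (by omega) hw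
  obtain ⟨t, hts, ht⟩ := hstep (hpred (hpred hyG hwy) hsw) (by omega) hs
  refine hall s hsw ?_ t hts ⟨i + 1, ?_⟩
  · rintro ⟨k, hk⟩
    have := hk.unique hs
    omega
  · convert ht using 1
    ring

/-! ### The gadget frame -/

/-- Points of the gadget frame: copies of the points of `W` in the layers `0, …, n`, a descending
chain of numbers, and leaves. -/
inductive GadgetPoint (W : Type) (n : ℕ) : Type
  | lay (w : W) (i : Fin (n + 1)) : GadgetPoint W n
  | num (k : ℕ) : GadgetPoint W n
  | leaf (i : ℕ) : GadgetPoint W n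

/-- The accessibility relation of the gadget frame. Even layers lie below the adjacent odd layers,
layer `0` lies below the number `0`, and the leaf `i` lies above the numbers exceeding `c i`. -/
inductive GadgetRel (M : Frame.{0}) (n : ℕ) (c : ℕ → ℕ) :
    GadgetPoint M.carrier n → GadgetPoint M.carrier n → Prop
  | lay {w v : M.carrier} {i j : Fin (n + 1)} (h : M.rel w v)
      (hij : i = j ∨ Even i.1 ∧ (j.1 = i.1 + 1 ∨ i.1 = j.1 + 1)) :
      GadgetRel M n c (.lay w i) (.lay v j)
  | lay_num (w : M.carrier) : GadgetRel M n c (.lay w 0) (.num 0)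
  | num {k l : ℕ} (h : l < k) : GadgetRel M n c (.num k) (.num l)
  | leaf {k i : ℕ} (h : c i < k) : GadgetRel M n c (.num k) (.leaf i)

/-- The gadget frame. -/
def gadget (M : Frame.{0}) (n : ℕ) (c : ℕ → ℕ) : Frame.{0} where
  carrier := GadgetPoint M.carrier n
  nonempty := ⟨.num 0⟩
  rel := GadgetRel M n c

/-- Sets of points whose trace on the numbers is finite or cofinite. -/
def gadgetAlg (M : Frame.{0}) (n : ℕ) (c : ℕ → ℕ) : Set (Set (gadget M n c).carrier) :=
  {A | {k : ℕ | GadgetPoint.num k ∈ A}.Finite ∨ {k : ℕ | GadgetPoint.num k ∈ A}ᶜ.Finite}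

theorem finite_or_finite_compl_of_isLowerSet {S : Set ℕ} (hS : ∀ k ∈ S, ∀ l ≤ k, l ∈ S) :
    S.Finite ∨ Sᶜ.Finite := by
  by_cases h : S = Set.univ
  · exact .inr (by simp [h])
  · obtain ⟨m, hm⟩ := (Set.ne_univ_iff_exists_notMem S).1 h
    exact .inl ((Set.finite_Iio m).subset fun k hk => by
      by_contra hmk
      exact hm (hS k hk m (not_lt.1 hmk)))

theorem not_finite_of_alternating {P : Set ℕ} {K k : ℕ} (hk : K < k) (hkP : k ∈ P)
    (h : ∀ k ∈ P, K < k → ∃ l, k < l ∧ l ∉ P ∧ ∃ m, l < m ∧ m ∈ P) :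
    ¬ (P.Finite ∨ Pᶜ.Finite) := by
  have hlarge : ∀ N, ∃ k ∈ P, K < k ∧ N ≤ k := by
    intro N
    induction N with
    | zero => exact ⟨k, hkP, hk, Nat.zero_le _⟩
    | succ N ih =>
      obtain ⟨k, hkP, hk, hN⟩ := ih
      obtain ⟨l, hl, -, m, hm, hmP⟩ := h k hkP hk
      exact ⟨m, hmP, by omega, by omega⟩
  rintro (hf | hf)
  · obtain ⟨N, hN⟩ := hf.bddAbove
    obtain ⟨k, hkP, -, hk⟩ := hlarge (N + 1)
    have := hN hkP
    omega
  · obtain ⟨N, hN⟩ := hf.bddAbove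
    obtain ⟨k, hkP, hk', hk⟩ := hlarge (N + 1)
    obtain ⟨l, hl, hlP, -⟩ := h k hkP hk'
    have := hN hlP
    omega

section Gadget

variable {M : Frame.{0}} {n : ℕ} {c : ℕ → ℕ}

theorem gadget_trans (hM : ∀ x y z, M.rel x y → M.rel y z → M.rel x z)
    (x y z : (gadget M n c).carrier) (hxy : (gadget M n c).rel x y)
    (hyz : (gadget M n c).rel y z) : (gadget M n c).rel x z := by
  cases hxy with
  | lay h hij =>
    cases hyz with
    | lay h' hij' =>
      refine .lay (hM _ _ _ h h') ?_
      rcases hij with rfl | ⟨hi, hij⟩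
      · exact hij'
      · rcases hij' with rfl | ⟨hj, -⟩
        · exact .inr ⟨hi, hij⟩
        · exfalso
          rw [Nat.even_iff] at hi hj
          omega
    | lay_num =>
      rcases hij with rfl | ⟨hi, hij⟩
      · exact .lay_num _
      · exfalso
        rw [Nat.even_iff] at hi
        simp only [Fin.val_zero] at hij
        omega
  | lay_num => cases hyz with
    | num h => exact absurd h (Nat.not_lt_zero _)
    | leaf h => exact absurd h (Nat.not_lt_zero _)
  | num h => cases hyz with
    | num h' => exact .num (h'.trans h)
    | leaf h' => exact .leaf (h'.trans h)
  | leaf h => cases hyz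

theorem gadgetAlg_isTenseAlgebra : IsTenseAlgebra (gadget M n c) (gadgetAlg M n c) where
  bot := .inl Set.finite_empty
  imp A hA B hB := by
    simp only [gadgetAlg, Set.mem_ofPred_eq] at *
    have : {k : ℕ | GadgetPoint.num k ∈ Aᶜ ∪ B} =
      {k : ℕ | GadgetPoint.num k ∈ A}ᶜ ∪ {k : ℕ | GadgetPoint.num k ∈ B} := rfl
    rw [this, Set.compl_union, compl_compl]
    rcases hA with hA | hA
    · exact .inr (hA.inter_of_left _)
    · rcases hB with hB | hB
      · exact .inl (hA.union hB)
      · exact .inr (hB.inter_of_right _)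
  box A _ := finite_or_finite_compl_of_isLowerSet fun k hk l hl y hy => hk y (by
    cases hy with
    | num h => exact .num (h.trans_le hl)
    | leaf h => exact .leaf (h.trans_le hl))
  pdia A _ := finite_or_finite_compl_of_isLowerSet fun k ⟨x, hx, hxk⟩ l hl => ⟨x, hx, by
    cases hxk with
    | lay_num w =>
      obtain rfl : l = 0 := by omega
      exact .lay_num w
    | num h => exact .num (hl.trans_lt h)⟩

theorem hasPath_leaf (j i : ℕ) : (gadget M n c).HasPath j (.leaf i) ↔ j = 0 := by
  cases j with
  | zero => simp [Frame.HasPath]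
  | succ j => exact iff_of_false (fun ⟨_, h, _⟩ => nomatch h) (by omega)

theorem hasPath_num (j k : ℕ) : (gadget M n c).HasPath j (.num k) ↔ j ≤ k := by
  induction j generalizing k with
  | zero => simp [Frame.HasPath]
  | succ j ih =>
    constructor
    · rintro ⟨y, hy, hj⟩
      cases hy with
      | num h => have := (ih _).1 hj; omega
      | leaf h => have := (hasPath_leaf _ _).1 hj; omega
    · intro h
      exact ⟨.num j, .num h, (ih j).2 le_rfl⟩

theorem hasRank_num (j k : ℕ) : (gadget M n c).HasRank j (.num k) ↔ j = k := by
  exact (and_congr (hasPath_num _ _) (not_congr (hasPath_num _ _))).trans (by omega)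

theorem hasRank_leaf (j i : ℕ) : (gadget M n c).HasRank j (.leaf i) ↔ j = 0 := by
  exact (and_congr (hasPath_leaf _ _) (not_congr (hasPath_leaf _ _))).trans (by omega)

theorem exists_hasRank_lay {j : ℕ} (w : M.carrier) (i : Fin (n + 1))
    (h : (gadget M n c).HasRank (j + 1) (.lay w i)) (m : ℕ) (hm : m ≤ j) :
    ∃ a : M.carrier × Fin (n + 1), (gadget M n c).HasRank (m + 1) (.lay a.1 a.2) := by
  induction j generalizing w i with
  | zero =>
    obtain rfl : m = 0 := by omega
    exact ⟨(w, i), h⟩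
  | succ j ih =>
    rcases hm.eq_or_lt with rfl | hm
    · exact ⟨(w, i), h⟩
    · obtain ⟨y, hy, hr⟩ := h.exists_succ
      cases hy with
      | lay _ _ => exact ih _ _ hr (by omega)
      | lay_num => exact absurd ((hasRank_num _ _).1 hr) (by omega)

theorem not_hasRank_lay [Finite M.carrier] {j : ℕ}
    (hj : Nat.card (M.carrier × Fin (n + 1)) < j) (w : M.carrier) (i : Fin (n + 1)) :
    ¬ (gadget M n c).HasRank j (.lay w i) := by
  intro h
  obtain ⟨j, rfl⟩ : ∃ k, j = k + 1 := ⟨j - 1, by omega⟩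
  choose f hf using fun m : Fin (j + 1) => exists_hasRank_lay w i h m.1 (by omega)
  have hinj : Function.Injective f := fun a b hab => by
    have h1 := hf a
    rw [hab] at h1
    have := h1.unique (hf b)
    exact Fin.ext (by omega)
  have := Nat.card_le_card_of_injective f hinj
  rw [Nat.card_eq_fintype_card, Fintype.card_fin] at this
  omega

theorem hasRank_iff [Finite M.carrier] {j : ℕ}
    (hj : Nat.card (M.carrier × Fin (n + 1)) < j) (x : (gadget M n c).carrier) :
    (gadget M n c).HasRank j x ↔ x = .num j := by
  cases x with
  | lay w i => exact iff_of_false (not_hasRank_lay hj w i) (fun h => nomatch h)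
  | num k =>
    rw [hasRank_num]
    exact ⟨fun h => h ▸ rfl, fun h => by cases h; rfl⟩
  | leaf i =>
    rw [hasRank_leaf]
    exact iff_of_false (by omega) (fun h => nomatch h)

theorem near_zero_lay (hM : ∀ x, ∃ y, M.rel x y ∨ M.rel y x) (i : ℕ) (hi : i < n + 1)
    (w : M.carrier) : (gadget M n c).Near (2 * i + 1) (.lay w ⟨i, hi⟩) (.num 0) := by
  induction i generalizing w with
  | zero => exact .succ (.lay_num w)
  | succ i ih =>
    have hi' : i < n + 1 := by omega
    let p (v : M.carrier) : (gadget M n c).carrier := .lay v ⟨i + 1, hi⟩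
    let q (v : M.carrier) : (gadget M n c).carrier := .lay v ⟨i, hi'⟩
    have hpp : ∀ {v w}, M.rel v w → (gadget M n c).rel (p v) (p w) := fun h => .lay h (.inl rfl)
    have key : ∃ v, (gadget M n c).Near 2 (p w) (q v) := by
      rcases Nat.even_or_odd i with he | ho
      · have hqp : ∀ {v w}, M.rel v w → (gadget M n c).rel (q v) (p w) := fun h =>
          .lay h (.inr ⟨he, .inl rfl⟩)
        obtain ⟨v, hv | hv⟩ := hM w
        · exact ⟨w, (Frame.Near.succ (hpp hv)).trans (.pred (hqp hv))⟩
        · exact ⟨v, (Frame.Near.pred (hqp hv)).mono one_le_two⟩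
      · have hpq : ∀ {v w}, M.rel v w → (gadget M n c).rel (p v) (q w) := fun h =>
          .lay h (.inr ⟨ho.add_one, .inr rfl⟩)
        obtain ⟨v, hv | hv⟩ := hM w
        · exact ⟨v, (Frame.Near.succ (hpq hv)).mono one_le_two⟩
        · exact ⟨w, (Frame.Near.pred (hpp hv)).trans (.succ (hpq hv))⟩
    obtain ⟨v, hv⟩ := key
    exact (hv.trans (ih hi' v)).mono (by omega)

theorem near_zero (hM : ∀ x, ∃ y, M.rel x y ∨ M.rel y x) (x : (gadget M n c).carrier) :
    (gadget M n c).Near (2 * n + 2) x (.num 0) := by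
  have hnum : ∀ k, (gadget M n c).Near 1 (.num k) (.num 0) := fun k => by
    rcases Nat.eq_zero_or_pos k with rfl | hk
    · exact ⟨_, .inl rfl, rfl⟩
    · exact .succ (.num hk)
  cases x with
  | lay w i => exact (near_zero_lay hM i.1 i.2 w).mono (by omega)
  | num k => exact (hnum k).mono (by omega)
  | leaf i =>
    have hr : (gadget M n c).rel (.num (c i + 1)) (.leaf i) := .leaf (Nat.lt_succ_self _)
    exact ((Frame.Near.pred hr).trans (hnum _)).mono (by omega)

theorem near_num (hM : ∀ x, ∃ y, M.rel x y ∨ M.rel y x) (x : (gadget M n c).carrier) {k : ℕ}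
    (hk : 0 < k) : (gadget M n c).Near (2 * n + 3) x (.num k) :=
  (near_zero hM x).trans (.pred (.num hk))

theorem near_leaf (hM : ∀ x, ∃ y, M.rel x y ∨ M.rel y x) (x : (gadget M n c).carrier) (i : ℕ) :
    (gadget M n c).Near (2 * n + 4) x (.leaf i) :=
  (near_num hM x (Nat.succ_pos (c i))).trans (.succ (.leaf (Nat.lt_succ_self _)))

/-! ### The logic of the gadget frame -/

theorem reach_mem_genLog [Finite M.carrier] (hM : ∀ x, ∃ y, M.rel x y ∨ M.rel y x) {K : ℕ}
    (hK : Nat.card (M.carrier × Fin (n + 1)) < K) :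
    reach (2 * n + 3) (rankFormula K) ∈ genLog (gadget M n c) (gadgetAlg M n c) := by
  intro V _ x
  rw [mem_val_reach]
  exact ⟨_, near_num hM x (by omega : 0 < K),
    (mem_val_rankFormula _ _ _ _).2 ((hasRank_num _ _).2 rfl)⟩

theorem next_mem_genLog [Finite M.carrier] {j : ℕ}
    (hj : Nat.card (M.carrier × Fin (n + 1)) < j) :
    .imp (rankFormula j) (.pdia (rankFormula (j + 1))) ∈
      genLog (gadget M n c) (gadgetAlg M n c) := by
  intro V _ x
  rw [mem_val_imp, mem_val_rankFormula, hasRank_iff hj, mem_val_pdia]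
  rintro rfl
  exact ⟨_, (mem_val_rankFormula _ _ _ _).2 ((hasRank_num _ _).2 rfl), .num (Nat.lt_succ_self j)⟩

theorem nonAlternating_mem_genLog [Finite M.carrier] {K : ℕ}
    (hK : Nat.card (M.carrier × Fin (n + 1)) < K) :
    .imp (rankFormula K) nonAlternating ∈ genLog (gadget M n c) (gadgetAlg M n c) := by
  intro V hV x
  rw [mem_val_imp, mem_val_rankFormula, hasRank_iff hK, mem_val_nonAlternating]
  rintro rfl ⟨y, hy, hyK⟩
  by_contra! hcon
  cases hyK with
  | lay_num => omega
  | num hk =>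
    refine not_finite_of_alternating (P := {k | GadgetPoint.num k ∈ V 0}) hk hy ?_ (hV 0)
    intro k hkV hk
    obtain ⟨z, hz, hzV, t, ht, htV⟩ := hcon _ (.num hk) hkV
    cases hz with
    | lay_num => omega
    | num hl =>
      cases ht with
      | lay_num => omega
      | num hm => exact ⟨_, hl, hzV, _, hm, htV⟩

theorem exists_not_mem_val_gadget [Finite M.carrier] (hM : ∀ x, ∃ y, M.rel x y ∨ M.rel y x)
    (G : Frame.{u}) (x : G.carrier) :
    ∃ ψ ∈ genLog (gadget M n c) (gadgetAlg M n c), ∃ V, x ∉ G.val V ψ :=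
  exists_not_mem_val gadgetAlg_isTenseAlgebra.isTenseLogic (2 * n + 3)
    (Nat.card (M.carrier × Fin (n + 1)) + 1) (reach_mem_genLog hM (Nat.lt_succ_self _))
    (fun _ hj => next_mem_genLog hj) (nonAlternating_mem_genLog (Nat.lt_succ_self _)) G x

/-- The formula `□⊥ ∧ ¬⧫γ ∧ ⧫γ'` with `γ`, `γ'` expressing rank `j` and `j + 1`. -/
def leafFormula (j : ℕ) : Formula :=
  conj (.box .bot) (conj (neg (.pdia (rankFormula j))) (.pdia (rankFormula (j + 1))))

theorem mem_val_leafFormula [Finite M.carrier] {j : ℕ}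
    (hj : Nat.card (M.carrier × Fin (n + 1)) < j) (V : ℕ → Set (gadget M n c).carrier)
    (x : (gadget M n c).carrier) :
    x ∈ (gadget M n c).val V (leafFormula j) ↔ ∃ i, x = .leaf i ∧ c i = j := by
  have hp : ∀ k, Nat.card (M.carrier × Fin (n + 1)) < k →
      (x ∈ (gadget M n c).val V (.pdia (rankFormula k)) ↔ GadgetRel M n c (.num k) x) := by
    intro k hk
    rw [mem_val_pdia]
    simp only [mem_val_rankFormula, hasRank_iff hk]
    exact ⟨fun ⟨y, hy, h⟩ => hy ▸ h, fun h => ⟨_, rfl, h⟩⟩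
  rw [leafFormula, mem_val_conj, mem_val_conj, mem_val_neg, mem_val_box, hp j hj,
    hp (j + 1) (by omega)]
  constructor
  · rintro ⟨h0, h1, h2⟩
    cases h2 with
    | num h =>
      rename_i k
      rcases Nat.eq_zero_or_pos k with rfl | hk
      · exact absurd (.num (by omega)) h1
      · exact (h0 _ (.num hk)).elim
    | leaf h =>
      refine ⟨_, rfl, ?_⟩
      by_contra hne
      exact h1 (.leaf (by omega))
  · rintro ⟨i, rfl, rfl⟩
    refine ⟨fun y hy => (nomatch hy), fun h => ?_, .leaf (Nat.lt_succ_self _)⟩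
    cases h with
    | leaf h => omega

/-- The modal depth of a formula. -/
def Formula.depth : Formula → ℕ
  | .var _ => 0
  | .bot => 0
  | .imp a b => max a.depth b.depth
  | .box a => a.depth + 1
  | .pdia a => a.depth + 1

/-- The valuation on the gadget frame copying `V` to all layers. -/
def gadgetVal (n : ℕ) (c : ℕ → ℕ) (V : ℕ → Set M.carrier) (p : ℕ) :
    Set (gadget M n c).carrier :=
  {x | ∃ w i, x = GadgetPoint.lay w i ∧ w ∈ V p}

theorem gadgetVal_mem (V : ℕ → Set M.carrier) (p : ℕ) : gadgetVal n c V p ∈ gadgetAlg M n c := by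
  refine .inl (Set.finite_empty.subset ?_)
  rintro k ⟨w, i, h, -⟩
  cases h

theorem lay_mem_val_iff (V : ℕ → Set M.carrier) (φ : Formula) (w : M.carrier) (i : Fin (n + 1))
    (h : φ.depth ≤ i.1) :
    GadgetPoint.lay w i ∈ (gadget M n c).val (gadgetVal n c V) φ ↔ w ∈ M.val V φ := by
  induction φ generalizing w i with
  | var p =>
    constructor
    · rintro ⟨w', i', h, hw⟩
      cases h
      exact hw
    · exact fun hw => ⟨w, i, rfl, hw⟩
  | bot => exact Iff.rfl
  | imp a b iha ihb =>
    simp only [Formula.depth, max_le_iff] at h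
    rw [mem_val_imp, ← iha w i h.1, ← ihb w i h.2]
    exact mem_val_imp _ _ _ _ _
  | box a ih =>
    simp only [Formula.depth] at h
    constructor
    · intro hx v hv
      exact (ih v i (by omega)).1 (hx _ (.lay hv (.inl rfl)))
    · intro hw y hy
      cases hy with
      | lay hv hij =>
        refine (ih _ _ ?_).2 (hw _ hv)
        rcases hij with rfl | ⟨-, hij⟩ <;> omega
      | lay_num => exact absurd h (by simp)
  | pdia a ih =>
    simp only [Formula.depth] at h
    constructor
    · rintro ⟨y, hy, hyx⟩
      cases hyx with
      | lay hv hij =>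
        refine ⟨_, (ih _ _ ?_).1 hy, hv⟩
        rcases hij with rfl | ⟨-, hij⟩ <;> omega
    · rintro ⟨v, hv, hvw⟩
      exact ⟨_, (ih v i (by omega)).2 hv, .lay hvw (.inl rfl)⟩

end Gadget

/-! ### Degrees of Kripke-incompleteness -/

theorem Fr_inter_eq {L L' : Set Formula} (h : IsTenseLogic L) (h' : IsTenseLogic L')
    (hno : ∀ (G : Frame.{u}) (x : G.carrier), ∃ ψ ∈ L', ∃ V, x ∉ G.val V ψ) :
    Fr.{u} (L ∩ L') = Fr.{u} L := by
  refine Set.Subset.antisymm (fun G hG φ hφ V x => ?_) (fun G hG φ hφ => hG φ hφ.1)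
  by_contra hx
  obtain ⟨ψ, hψ, V', hx'⟩ := hno G x
  have h1 := h.subst φ (fun i => .var (2 * i)) hφ
  have h2 := h'.subst ψ (fun i => .var (2 * i + 1)) hψ
  have hmem : Formula.imp (neg (φ.subst fun i => .var (2 * i)))
      (ψ.subst fun i => .var (2 * i + 1)) ∈ L ∩ L' :=
    ⟨h.mp _ _ h1 (h.taut _ (by intro e hb hi; simp only [neg, hi]; tauto)),
      h'.mp _ _ h2 (h'.taut _ (by intro e hb hi; simp only [neg, hi]; tauto))⟩
  have := hG _ hmem (fun i => if i % 2 = 0 then V (i / 2) else V' (i / 2)) x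
  rw [mem_val_imp, mem_val_neg, val_subst, val_subst] at this
  have e1 : ∀ i, (2 * i) / 2 = i := fun i => by omega
  have e2 : ∀ i, (2 * i + 1) / 2 = i := fun i => by omega
  have e3 : ∀ i, (2 * i + 1) % 2 = 1 := fun i => by omega
  simp only [Frame.val, Nat.mul_mod_right, if_true, e1, e2, e3, one_ne_zero, if_false] at this
  exact hx' (this hx)

/-- An injective coding of formulas by natural numbers. -/
def Formula.code : Formula → ℕ
  | .var i => 5 * i
  | .bot => 1
  | .imp a b => 5 * Nat.pair a.code b.code + 2
  | .box a => 5 * a.code + 3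
  | .pdia a => 5 * a.code + 4

theorem Formula.code_injective : Function.Injective Formula.code := by
  intro a
  induction a with
  | var i => intro b h; cases b <;> simp only [Formula.code] at h <;> first | omega | (congr 1; omega)
  | bot => intro b h; cases b <;> simp only [Formula.code] at h <;> first | rfl | omega
  | imp a a' ih ih' =>
    intro b h
    cases b <;> simp only [Formula.code] at h <;> try omega
    rename_i b b'
    have h1 : Nat.pair a.code a'.code = Nat.pair b.code b'.code := by omega
    rw [Nat.pair_eq_pair] at h1
    rw [ih h1.1, ih' h1.2]
  | box a ih =>
    intro b h
    cases b <;> simp only [Formula.code] at h <;> try omega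
    rw [ih (Nat.eq_of_mul_eq_mul_left (by decide : 0 < 5) (Nat.add_right_cancel h))]
  | pdia a ih =>
    intro b h
    cases b <;> simp only [Formula.code] at h <;> try omega
    rw [ih (Nat.eq_of_mul_eq_mul_left (by decide : 0 < 5) (Nat.add_right_cancel h))]

theorem mk_set_formula_le : Cardinal.mk (Set Formula) ≤ 2 ^ Cardinal.aleph0 := by
  rw [Cardinal.mk_set]
  have : Countable Formula := Formula.code_injective.countable
  exact Cardinal.power_le_power_left two_ne_zero Cardinal.mk_le_aleph0

theorem deg_eq {L : Set Formula} (hL : L ∈ NExt K4t) {φ : Formula} (hφ : φ ∈ L)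
    (hφ' : φ ∉ splitLogic) : deg.{u} K4t L = 2 ^ Cardinal.aleph0 := by
  classical
  refine le_antisymm ((Cardinal.mk_subtype_le _).trans mk_set_formula_le) ?_
  obtain ⟨M, V, x, hfin, htrans, hM, hx⟩ := exists_finite_frame hφ'
  let n := φ.depth
  let K := Nat.card (M.carrier × Fin (n + 1)) + 1
  let c : Set ℕ → ℕ → ℕ := fun I i => if i ∈ I then K + i else 0
  let T : Set ℕ → Set Formula := fun I => genLog (gadget M n (c I)) (gadgetAlg M n (c I))
  have hT : ∀ I, T I ∈ NExt K4t := fun I =>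
    gadgetAlg_isTenseAlgebra.genLog_mem_NExt (gadget_trans htrans)
  have hleaf : ∀ I i, (∃ l, c I l = K + i) ↔ i ∈ I := by
    intro I i
    constructor
    · rintro ⟨l, hl⟩
      by_cases h : l ∈ I
      · simp only [c, h, if_true] at hl
        obtain rfl : l = i := by omega
        exact h
      · simp only [c, h, if_false] at hl
        omega
    · exact fun h => ⟨i, by simp [c, h]⟩
  have hmem : ∀ I i, .imp (reach (2 * n + 4) (leafFormula (K + i))) φ ∈ L ∩ T I ↔ i ∉ I := by
    intro I i
    have hKi : Nat.card (M.carrier × Fin (n + 1)) < K + i := by omega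
    constructor
    · rintro ⟨-, h⟩ hi
      have h1 := h _ (gadgetVal_mem V) (.lay x (Fin.last n))
      obtain ⟨l, hl⟩ := (hleaf I i).2 hi
      exact hx ((lay_mem_val_iff V φ x (Fin.last n) le_rfl).1
        ((mem_val_imp _ _ _ _ _).1 h1 ((mem_val_reach _ _ _ _ _).2 ⟨_, near_leaf hM _ l,
        (mem_val_leafFormula hKi _ _).2 ⟨l, rfl, hl⟩⟩)))
    · intro hi
      refine ⟨hL.1.mp _ _ hφ (hL.1.taut _ (by intro e hb hi; simp only [hi]; tauto)),
        fun V' _ y => ?_⟩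
      rw [mem_val_imp, mem_val_reach]
      rintro ⟨z, -, hz⟩
      obtain ⟨l, -, hl⟩ := (mem_val_leafFormula hKi _ _).1 hz
      exact absurd ((hleaf I i).1 ⟨l, hl⟩) hi
  have hinj : Function.Injective (fun I : Set ℕ =>
      (⟨L ∩ T I, ⟨hL.1.inter (hT I).1, Set.subset_inter hL.2 (hT I).2⟩,
        Fr_inter_eq hL.1 (hT I).1 fun G y => exists_not_mem_val_gadget hM G y⟩ :
        {L' : Set Formula // L' ∈ NExt K4t ∧ Fr.{u} L' = Fr.{u} L})) := by
    intro I J hIJ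
    have h : L ∩ T I = L ∩ T J := congrArg Subtype.val hIJ
    ext i
    rw [← not_iff_not, ← hmem I i, ← hmem J i, h]
  simpa [Cardinal.mk_set, deg] using Cardinal.mk_le_of_injective hinj

end TenseLogic

theorem mainTheorem9 :
    -- the splitting `K4_t/•` of `NExt(K4_t)` by `Log(•)` exists and is unique
    (∃! Lstar : Set TenseLogic.Formula,
      TenseLogic.IsSplittingPair TenseLogic.K4t (TenseLogic.Log {TenseLogic.bullet}) Lstar) ∧
    ∀ Lstar : Set TenseLogic.Formula,
      TenseLogic.IsSplittingPair TenseLogic.K4t (TenseLogic.Log {TenseLogic.bullet}) Lstar →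
      ∀ L ∈ TenseLogic.NExt TenseLogic.K4t \ {TenseLogic.K4t, Lstar},
        TenseLogic.deg.{u} TenseLogic.K4t L = 2 ^ Cardinal.aleph0 := by
  have hs := TenseLogic.isSplittingPair_splitLogic
  refine ⟨⟨_, hs, fun L hL => hs.unique hL⟩, ?_⟩
  rintro Lstar hstar L ⟨hL, hne⟩
  obtain rfl := hs.unique hstar
  simp only [Set.mem_insert_iff, Set.mem_singleton_iff, not_or] at hne
  obtain ⟨φ, hφ, hφ'⟩ := TenseLogic.exists_mem_not_mem_splitLogic hL hne.1 hne.2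
  exact TenseLogic.deg_eq hL hφ hφ'
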